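/- **Terms.** Fix a denumerable set $\mathcal V$ of variables. Terms are $M ::= x \mid M\,M \mid \lambda x.M$, up to renaming of bound variables. For a finite sequence $S$ of variables, $M\uparrow S$ means that no variable of $S$ is free in $M$; $M\{x:=N\}$ is capture-avoiding substitution. The bound variables of a term considered under $S$ are always chosen distinct from each other, from the free variables and from the variables of $S$. **Supersteps.** The judgement $M\Rrightarrow_{S,k}N$ ($S$ a finite sequence of variables, $k\ge 0$ an integer) is inductively defined by the rules: - (Var) $x\Rrightarrow_{S,0}x$. - (Abs1) If $M\Rrightarrow_{x\cdot S,0}M'$, then $\lambda x.M\Rrightarrow_{S,0}\lambda x.M'$. - (Abs2) If $M\Rrightarrow_{S,k}M'$, then $\lambda x.M\Rrightarrow_{S,k+1}\lambda x.M'$. - (App1) If $M\Rrightarrow_{S,0}M'$ and $N\Rrightarrow_{S,0}N'$, then $M\,N\Rrightarrow_{S,0}M'\,N'$. - (App2) If $M\Rrightarrow_{S,n+1}\lambda x.M'$, $N\Rrightarrow_{S,m}N'$, $(\lambda x.M')\,N'\uparrow S$, and $m>0$ implies $M'=\lambda x_1\cdots x_n.x$, with $x$ distinct from $x_1,\dots,x_n$,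 then $M\,N\Rrightarrow_{S,n+m}M'\{x:=N'\}$. **Labeled weak reduction.** Fix a denumerable set of labels with a distinguished label $\star$ that is never bound. Labeled terms are $A ::= x\mid \lambda^a x.A\mid @^a(A,A)$, where in $@^a(A,B)$ the label $a\neq\star$ is bound in $A$ (but not in $B$); labeled terms are taken up to renaming of bound variables and of bound labels, and substitution $A\{x:=B\}$ captures neither variables nor labels. $A\{a:=\star\}$ replaces the free occurrences of $a$ in $A$ by $\star$. Erasing all labels of $A$ gives a term $|A|$, and $A$ is called a labeling of $|A|$. For a one-hole labeled context $C$, let $\mathrm{bp}(C)$ be the sequence of variables bound in $C$ above its hole. One-step reduction $\to_S$ is given by $$C[@^a(\lambda^a x.A,\,B)]\;\to_S\;C[A\{a:=\star\}\{x:=B\}]\qquad\text{whenever no variable of } \mathrm{bp}(C) \text{ or of } S \text{ is free in } @^a(\lambda^a x.A,\,B).$$ Let $\twoheadrightarrow_S$ be the reflexive-transitive closure of $\to_S$; a labeled term is in normal form (with respect to $\to_S$) if no $\to_S$ step starts from it. **Theorem (equivalence of presentations).** Let $S$ be a finite sequence of variables and let $M,N$ be terms. 1. If $M\Rrightarrow_{S,0}N$,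 then there are a labeling $M_\ell$ of $M$ and a labeling $N_\ell$ of $N$ such that $M_\ell\twoheadrightarrow_S N_\ell$. 2. For every labeling $M_\ell$ of $M$ and every labeling $N_\ell$ of $N$: if $M_\ell\twoheadrightarrow_S N_\ell$ and $N_\ell$ is in normal form, then $M\Rrightarrow_{S,0}N$. -/

import Mathlib

/-! Weak lambda calculus terms and their labeled variant.

Terms are taken up to renaming of bound variables and, for labeled terms, up to renaming of bound
labels. Both alpha-equivalences are made into syntactic equality by de Bruijn indices: a variable
(label) index that points past all enclosing binders denotes a free variable (label), so the
denumerable sets of variables and of proper labels are both enumerated by `ℕ`. Going below a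
variable binder, the bound variable gets index `0` and every other variable `x` becomes `x + 1`. -/

namespace WeakLambda

/-- Terms `M ::= x | M M | λx.M`. -/
inductive Term : Type
  | var (x : ℕ) : Term
  | app (M N : Term) : Term
  | lam (M : Term) : Term

/-- A renaming of variables, extended below a binder. -/
def liftRen (ρ : ℕ → ℕ) : ℕ → ℕ
  | 0 => 0
  | x + 1 => ρ x + 1

/-- The sequence `x · S` seen from the body of an abstraction `λx`. -/
def consVar (S : List ℕ) : List ℕ := 0 :: S.map Nat.succ

/-- The sequence `S` (not containing `x`) seen from the body of an abstraction `λx`. -/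
def shiftVars (S : List ℕ) : List ℕ := S.map Nat.succ

namespace Term

/-- The set of free variables. -/
def FV : Term → Set ℕ
  | var x => {x}
  | app M N => M.FV ∪ N.FV
  | lam M => {x | x + 1 ∈ M.FV}

/-- `M ↑ S`: the free variables of `M` are disjoint from `S`. -/
def Away (M : Term) (S : List ℕ) : Prop := ∀ x ∈ S, x ∉ M.FV

/-- Renaming of free variables. -/
def rename : (ℕ → ℕ) → Term → Term
  | ρ, var x => var (ρ x)
  | ρ, app M N => app (M.rename ρ) (N.rename ρ)
  | ρ, lam M => lam (M.rename (liftRen ρ))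

/-- A simultaneous substitution, extended below a binder. -/
def liftSubst (σ : ℕ → Term) : ℕ → Term
  | 0 => var 0
  | x + 1 => (σ x).rename Nat.succ

/-- Simultaneous capture-avoiding substitution. -/
def subst : (ℕ → Term) → Term → Term
  | σ, var x => σ x
  | σ, app M N => app (M.subst σ) (N.subst σ)
  | σ, lam M => lam (M.subst (liftSubst σ))

/-- `M{x := N}`, where `M` is the body of an abstraction `λx.M`. -/
def inst (M N : Term) : Term :=
  M.subst fun
    | 0 => N
    | x + 1 => var x

end Term

/-- The superstep judgement `M ⇛_{S,k} N`. In `app2`, the term `lam^[n] (var n)` is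
`λx₁…xₙ.x`, with `x` the variable bound by the abstraction whose body it is. -/
inductive Superstep : List ℕ → ℕ → Term → Term → Prop
  | var (S : List ℕ) (x : ℕ) : Superstep S 0 (.var x) (.var x)
  | abs1 {S : List ℕ} {M M' : Term} :
      Superstep (consVar S) 0 M M' → Superstep S 0 (.lam M) (.lam M')
  | abs2 {S : List ℕ} {k : ℕ} {M M' : Term} :
      Superstep (shiftVars S) k M M' → Superstep S (k + 1) (.lam M) (.lam M')
  | app1 {S : List ℕ} {M M' N N' : Term} :
      Superstep S 0 M M' → Superstep S 0 N N' → Superstep S 0 (.app M N) (.app M' N')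
  | app2 {S : List ℕ} {n m : ℕ} {M M' N N' : Term} :
      Superstep S (n + 1) M (.lam M') → Superstep S m N N' →
      (Term.app (.lam M') N').Away S →
      (0 < m → M' = Term.lam^[n] (.var n)) →
      Superstep S (n + m) (.app M N) (M'.inst N')

/-- Labels: the distinguished label `⋆`, which is never bound, and the other labels, as
de Bruijn indices with respect to the binding applications. -/
inductive Label : Type
  | star : Label
  | idx (a : ℕ) : Label

/-- Replace the proper labels according to `g`; the label `⋆` is left alone. -/
def Label.map (g : ℕ → Label) : Label → Label
  | star => star
  | idx a => g a

/-- A replacement of labels, extended below an application that binds a label. -/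
def liftLabel (g : ℕ → Label) : ℕ → Label
  | 0 => .idx 0
  | a + 1 => (g a).map fun b => .idx (b + 1)

/-- Labeled terms. `lam a A` is an abstraction decorated with the label `a`; `app A B` is an
application decorated with a (nameless) label that is bound in `A`, where it has index `0`,
and not in `B`. -/
inductive LTerm : Type
  | var (x : ℕ) : LTerm
  | lam (a : Label) (A : LTerm) : LTerm
  | app (A B : LTerm) : LTerm

namespace LTerm

/-- Erasure of all labels; `A` is a labeling of `A.erase`. -/
def erase : LTerm → Term
  | var x => .var x
  | lam _ A => .lam A.erase
  | app A B => .app A.erase B.erase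

/-- The set of free variables. -/
def FV : LTerm → Set ℕ
  | var x => {x}
  | lam _ A => {x | x + 1 ∈ A.FV}
  | app A B => A.FV ∪ B.FV

/-- `A ↑ S`: the free variables of `A` are disjoint from `S`. -/
def Away (A : LTerm) (S : List ℕ) : Prop := ∀ x ∈ S, x ∉ A.FV

/-- Renaming of free variables. -/
def rename : (ℕ → ℕ) → LTerm → LTerm
  | ρ, var x => var (ρ x)
  | ρ, lam a A => lam a (A.rename (liftRen ρ))
  | ρ, app A B => app (A.rename ρ) (B.rename ρ)

/-- Replacement of free labels. -/
def relabel : (ℕ → Label) → LTerm → LTerm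
  | _, var x => var x
  | g, lam a A => lam (a.map g) (A.relabel g)
  | g, app A B => app (A.relabel (liftLabel g)) (B.relabel g)

/-- A labeled term seen from the first argument of an application. -/
def shiftLabels (A : LTerm) : LTerm := A.relabel fun a => .idx (a + 1)

/-- `A{a := ⋆}`, where `A` is a term in the scope of an application that binds `a`; the result
lives outside that scope. -/
def starLabel (A : LTerm) : LTerm :=
  A.relabel fun
    | 0 => .star
    | a + 1 => .idx a

/-- A simultaneous substitution, extended below an abstraction. -/
def liftSubst (σ : ℕ → LTerm) : ℕ → LTerm
  | 0 => var 0
  | x + 1 => (σ x).rename Nat.succ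

/-- Simultaneous substitution that captures neither variables nor labels. -/
def subst : (ℕ → LTerm) → LTerm → LTerm
  | σ, var x => σ x
  | σ, lam a A => lam a (A.subst (liftSubst σ))
  | σ, app A B => app (A.subst fun x => (σ x).shiftLabels) (B.subst σ)

/-- `A{x := B}`, where `A` is the body of an abstraction `λx.A`. -/
def inst (A B : LTerm) : LTerm :=
  A.subst fun
    | 0 => B
    | x + 1 => var x

end LTerm

/-- Labeled contexts, with exactly one hole. -/
inductive LCtx : Type
  | hole : LCtx
  | lam (a : Label) (C : LCtx) : LCtx
  | appL (C : LCtx) (A : LTerm) : LCtx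
  | appR (A : LTerm) (C : LCtx) : LCtx

namespace LCtx

/-- `C[A]`; free variables and free labels of `A` may become bound. -/
def fill : LCtx → LTerm → LTerm
  | hole, A => A
  | lam a C, A => .lam a (C.fill A)
  | appL C B, A => .app (C.fill A) B
  | appR B C, A => .app B (C.fill A)

/-- The binding path of `C` concatenated with `S`, seen from the hole of `C`. -/
def path : LCtx → List ℕ → List ℕ
  | hole, S => S
  | lam _ C, S => C.path (consVar S)
  | appL C _, S => C.path S
  | appR _ C, S => C.path S

end LCtx

namespace LTerm

/-- Labeled weak reduction `→_S`: in any context `C`, a redex `(λᵃx.A) B` whose application binds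
the label `a` of its abstraction is contracted to `A{a := ⋆}{x := B}`, provided that the redex is
away from the binding path of `C` and from `S`. -/
inductive Step (S : List ℕ) : LTerm → LTerm → Prop
  | contract (C : LCtx) (A B : LTerm) :
      (app (lam (.idx 0) A) B).Away (C.path S) →
      Step S (C.fill (app (lam (.idx 0) A) B)) (C.fill (A.starLabel.inst B))

/-- `↠_S`, the reflexive-transitive closure of `→_S`. -/
def Steps (S : List ℕ) : LTerm → LTerm → Prop := Relation.ReflTransGen (Step S)

/-- `A` is a normal form of `→_S`. -/
def IsNormal (S : List ℕ) (A : LTerm) : Prop := ∀ B, ¬ Step S A B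

end LTerm

end WeakLambda

namespace WeakLambda

/-! The index `k` of a superstep counts the abstractions at the head of the result that enclosing
applications are going to consume. Labels make this bookkeeping explicit, so both halves go through
`Eval`, the superstep judgement on labeled terms, which erases to `Superstep` (`Eval.superstep`).

For the first half, a superstep derivation itself dictates a labeling (`Superstep.exists_eval`): an
abstraction that will be consumed gets the label of its consumer, any other gets `⋆`. An `Eval`
derivation is then realized by reduction (`Eval.headSteps`). Each redex is contracted before its
body and argument are evaluated, since the weak side condition blocks redexes containing a variable
that is still bound above them.

For the second half, `exists_eval_normal` shows by structural induction that every labeled term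
evaluates to some normal form, which it therefore also reaches by reduction. Reduction is confluent,
because parallel reduction has the diamond property (`Par.diamond`). Hence this normal form is the
given one, and erasing the evaluation yields the superstep. -/

@[simp] theorem zero_mem_consVar (S : List ℕ) : 0 ∈ consVar S := by simp [consVar]

@[simp] theorem succ_mem_consVar (S : List ℕ) (x : ℕ) : x + 1 ∈ consVar S ↔ x ∈ S := by
  simp [consVar]

@[simp] theorem zero_notMem_shiftVars (S : List ℕ) : 0 ∉ shiftVars S := by simp [shiftVars]

@[simp] theorem succ_mem_shiftVars (S : List ℕ) (x : ℕ) : x + 1 ∈ shiftVars S ↔ x ∈ S := by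
  simp [shiftVars]

theorem Label.map_map (f g : ℕ → Label) (a : Label) :
    (a.map f).map g = a.map fun b => (f b).map g := by
  cases a <;> rfl

theorem Label.map_idx (a : Label) : a.map Label.idx = a := by
  cases a <;> rfl

theorem liftLabel_idx : liftLabel Label.idx = Label.idx := by
  funext a; cases a <;> rfl

theorem liftLabel_comp (f g : ℕ → Label) :
    (fun a => (liftLabel f a).map (liftLabel g)) = liftLabel fun a => (f a).map g := by
  funext a
  cases a with
  | zero => rfl
  | succ a =>
    simp only [liftLabel, Label.map_map]
    rfl

namespace LTerm

/-! ### Syntactic identities -/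

theorem relabel_relabel (A : LTerm) (f g : ℕ → Label) :
    (A.relabel f).relabel g = A.relabel fun a => (f a).map g := by
  induction A generalizing f g with
  | var x => rfl
  | lam a A ih => simp [relabel, ih, Label.map_map]
  | app A B ihA ihB => simp [relabel, ihA, ihB, liftLabel_comp]

theorem relabel_idx (A : LTerm) : A.relabel Label.idx = A := by
  induction A with
  | var x => rfl
  | lam a A ih => simp [relabel, ih, Label.map_idx]
  | app A B ihA ihB => simp [relabel, ihA, ihB, liftLabel_idx]

theorem starLabel_shiftLabels (A : LTerm) : A.shiftLabels.starLabel = A := by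
  rw [starLabel, shiftLabels, relabel_relabel]
  exact relabel_idx A

theorem shiftLabels_relabel (A : LTerm) (g : ℕ → Label) :
    A.shiftLabels.relabel (liftLabel g) = (A.relabel g).shiftLabels := by
  simp only [shiftLabels, relabel_relabel]
  rfl

theorem starLabel_relabel (A : LTerm) (g : ℕ → Label) :
    (A.relabel (liftLabel g)).starLabel = A.starLabel.relabel g := by
  simp only [starLabel, relabel_relabel]
  congr 1
  funext a
  cases a with
  | zero => rfl
  | succ a =>
    simp only [liftLabel, Label.map_map]
    exact Label.map_idx _

theorem rename_relabel (A : LTerm) (ρ : ℕ → ℕ) (g : ℕ → Label) :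
    (A.rename ρ).relabel g = (A.relabel g).rename ρ := by
  induction A generalizing ρ g with
  | var x => rfl
  | lam a A ih => simp [rename, relabel, ih]
  | app A B ihA ihB => simp [rename, relabel, ihA, ihB]

theorem liftSubst_var (ρ : ℕ → ℕ) :
    (liftSubst fun x => var (ρ x)) = fun x => var (liftRen ρ x) := by
  funext x; cases x <;> rfl

theorem rename_eq_subst (A : LTerm) (ρ : ℕ → ℕ) :
    A.rename ρ = A.subst fun x => var (ρ x) := by
  induction A generalizing ρ with
  | var x => rfl
  | lam a A ih => simp [rename, subst, ih, liftSubst_var]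
  | app A B ihA ihB =>
    simp only [rename, subst, ihA, ihB]
    rfl

theorem subst_var (A : LTerm) : A.subst var = A := by
  have h : liftSubst var = var := by funext x; cases x <;> rfl
  induction A with
  | var x => rfl
  | lam a A ih => simp [subst, h, ih]
  | app A B ihA ihB =>
    simp only [subst, ihB]
    exact congrArg (app · B) ihA

theorem subst_rename (A : LTerm) (ρ : ℕ → ℕ) (σ : ℕ → LTerm) :
    (A.rename ρ).subst σ = A.subst fun x => σ (ρ x) := by
  induction A generalizing ρ σ with
  | var x => rfl
  | lam a A ih =>
    simp only [rename, subst, ih]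
    congr 2
    funext x; cases x <;> rfl
  | app A B ihA ihB => simp [rename, subst, ihA, ihB]

theorem rename_rename (A : LTerm) (ρ τ : ℕ → ℕ) :
    (A.rename ρ).rename τ = A.rename fun x => τ (ρ x) := by
  induction A generalizing ρ τ with
  | var x => rfl
  | lam a A ih =>
    simp only [rename, ih]
    congr 2
    funext x; cases x <;> rfl
  | app A B ihA ihB => simp [rename, ihA, ihB]

theorem rename_subst (A : LTerm) (σ : ℕ → LTerm) (ρ : ℕ → ℕ) :
    (A.subst σ).rename ρ = A.subst fun x => (σ x).rename ρ := by
  induction A generalizing ρ σ with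
  | var x => rfl
  | lam a A ih =>
    simp only [rename, subst, ih]
    congr 2
    funext x
    cases x with
    | zero => rfl
    | succ x => simp only [liftSubst, rename_rename]; rfl
  | app A B ihA ihB => simp [rename, subst, ihA, ihB, shiftLabels, rename_relabel]

theorem relabel_liftSubst (σ : ℕ → LTerm) (g : ℕ → Label) :
    (fun x => (liftSubst σ x).relabel g) = liftSubst fun x => (σ x).relabel g := by
  funext x
  cases x with
  | zero => rfl
  | succ x => exact rename_relabel _ _ _

theorem relabel_subst (A : LTerm) (σ : ℕ → LTerm) (g : ℕ → Label) :
    (A.subst σ).relabel g = (A.relabel g).subst fun x => (σ x).relabel g := by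
  induction A generalizing g σ with
  | var x => rfl
  | lam a A ih => simp only [relabel, subst, ih, relabel_liftSubst]
  | app A B ihA ihB => simp only [relabel, subst, ihA, ihB, shiftLabels_relabel]

theorem subst_subst (A : LTerm) (σ τ : ℕ → LTerm) :
    (A.subst σ).subst τ = A.subst fun x => (σ x).subst τ := by
  induction A generalizing σ τ with
  | var x => rfl
  | lam a A ih =>
    simp only [subst, ih]
    congr 2
    funext x
    cases x with
    | zero => rfl
    | succ x => simp only [liftSubst, subst_rename, rename_subst]
  | app A B ihA ihB =>
    simp only [subst, ihA, ihB]
    congr 2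
    funext x
    exact (relabel_subst _ _ _).symm

/-- The substitution of `B` for the variable `0`. -/
def instMap (B : LTerm) : ℕ → LTerm
  | 0 => B
  | x + 1 => var x

theorem inst_eq_subst (A B : LTerm) : A.inst B = A.subst (instMap B) := rfl

theorem subst_starLabel (A : LTerm) (σ : ℕ → LTerm) :
    (A.subst σ).starLabel = A.starLabel.subst fun x => (σ x).starLabel :=
  relabel_subst _ _ _

theorem starLabel_rename (A : LTerm) (ρ : ℕ → ℕ) :
    (A.rename ρ).starLabel = A.starLabel.rename ρ :=
  rename_relabel _ _ _

theorem starLabel_iterate_rename (n : ℕ) (A : LTerm) (ρ : ℕ → ℕ) :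
    starLabel^[n] (A.rename ρ) = (starLabel^[n] A).rename ρ := by
  induction n generalizing A with
  | zero => rfl
  | succ n ih => simp only [Function.iterate_succ_apply, starLabel_rename, ih]

theorem starLabel_iterate_var (n x : ℕ) : starLabel^[n] (var x) = var x := by
  induction n with
  | zero => rfl
  | succ n ih => rw [Function.iterate_succ_apply]; exact ih

theorem starLabel_iterate_shiftLabels_iterate (n : ℕ) (A : LTerm) :
    starLabel^[n] (shiftLabels^[n] A) = A :=
  (Function.LeftInverse.iterate starLabel_shiftLabels n) A

/-- Contraction commutes with substitution. Inside the function part `σ` is shifted past the label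
bound by the application, and `starLabel` undoes exactly that shift. -/
theorem inst_starLabel_subst (A B : LTerm) (σ : ℕ → LTerm) :
    (A.starLabel.inst B).subst σ =
      (A.subst (liftSubst fun x => (σ x).shiftLabels)).starLabel.inst (B.subst σ) := by
  rw [inst_eq_subst, inst_eq_subst, subst_subst, subst_starLabel, subst_subst]
  congr 1
  funext x
  cases x with
  | zero => rfl
  | succ x =>
    simp only [liftSubst, starLabel_rename, starLabel_shiftLabels, subst_rename]
    exact (subst_var _).symm

theorem inst_starLabel_rename (A B : LTerm) (ρ : ℕ → ℕ) :
    (A.starLabel.inst B).rename ρ =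
      (A.rename (liftRen ρ)).starLabel.inst (B.rename ρ) := by
  simp only [rename_eq_subst, inst_starLabel_subst, ← liftSubst_var]
  rfl

theorem inst_starLabel_relabel (A B : LTerm) (g : ℕ → Label) :
    (A.starLabel.inst B).relabel g =
      (A.relabel (liftLabel g)).starLabel.inst (B.relabel g) := by
  rw [inst_eq_subst, inst_eq_subst, relabel_subst, starLabel_relabel]
  congr 1
  funext x; cases x <;> rfl

/-! ### Erasure -/

theorem erase_relabel (A : LTerm) (g : ℕ → Label) : (A.relabel g).erase = A.erase := by
  induction A generalizing g with
  | var x => rfl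
  | lam a A ih => simp [relabel, erase, ih]
  | app A B ihA ihB => simp [relabel, erase, ihA, ihB]

theorem erase_iterate_starLabel (n : ℕ) (A : LTerm) : (starLabel^[n] A).erase = A.erase := by
  induction n generalizing A with
  | zero => rfl
  | succ n ih => rw [Function.iterate_succ_apply, ih]; exact erase_relabel _ _

theorem erase_iterate_shiftLabels (n : ℕ) (A : LTerm) :
    (shiftLabels^[n] A).erase = A.erase := by
  induction n generalizing A with
  | zero => rfl
  | succ n ih => rw [Function.iterate_succ_apply, ih]; exact erase_relabel _ _

theorem erase_rename (A : LTerm) (ρ : ℕ → ℕ) : (A.rename ρ).erase = A.erase.rename ρ := by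
  induction A generalizing ρ with
  | var x => rfl
  | lam a A ih => simp [rename, Term.rename, erase, ih]
  | app A B ihA ihB => simp [rename, Term.rename, erase, ihA, ihB]

theorem erase_subst (A : LTerm) (σ : ℕ → LTerm) :
    (A.subst σ).erase = A.erase.subst fun x => (σ x).erase := by
  induction A generalizing σ with
  | var x => rfl
  | lam a A ih =>
    simp only [subst, Term.subst, erase, ih]
    congr 2
    funext x
    cases x with
    | zero => rfl
    | succ x => exact erase_rename _ _
  | app A B ihA ihB => simp [subst, Term.subst, erase, ihA, ihB, shiftLabels, erase_relabel]

theorem erase_inst (A B : LTerm) : (A.inst B).erase = A.erase.inst B.erase := by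
  rw [inst_eq_subst, erase_subst, Term.inst]
  congr 1
  funext x; cases x <;> rfl

theorem FV_erase (A : LTerm) : A.erase.FV = A.FV := by
  induction A with
  | var x => rfl
  | lam a A ih => simp [erase, Term.FV, FV, ih]
  | app A B ihA ihB => simp [erase, Term.FV, FV, ihA, ihB]

theorem away_erase (A : LTerm) (S : List ℕ) : A.erase.Away S ↔ A.Away S := by
  simp [Term.Away, Away, FV_erase]

/-! ### Free variables -/

theorem FV_relabel (A : LTerm) (g : ℕ → Label) : (A.relabel g).FV = A.FV := by
  rw [← FV_erase, erase_relabel, FV_erase]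

theorem FV_starLabel (A : LTerm) : A.starLabel.FV = A.FV := FV_relabel _ _

theorem FV_shiftLabels (A : LTerm) : A.shiftLabels.FV = A.FV := FV_relabel _ _

theorem FV_iterate_starLabel (n : ℕ) (A : LTerm) : (starLabel^[n] A).FV = A.FV := by
  rw [← FV_erase, erase_iterate_starLabel, FV_erase]

theorem mem_FV_rename (A : LTerm) (ρ : ℕ → ℕ) (x : ℕ) :
    x ∈ (A.rename ρ).FV ↔ ∃ y ∈ A.FV, ρ y = x := by
  induction A generalizing ρ x with
  | var y => simp [rename, FV, eq_comm]
  | lam a A ih =>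
    change x + 1 ∈ (A.rename (liftRen ρ)).FV ↔ ∃ y, y + 1 ∈ A.FV ∧ ρ y = x
    rw [ih]
    constructor
    · rintro ⟨y, hy, h⟩
      cases y with
      | zero => simp [liftRen] at h
      | succ y => exact ⟨y, hy, by simpa [liftRen] using h⟩
    · rintro ⟨y, hy, h⟩
      exact ⟨y + 1, hy, by simp [liftRen, h]⟩
  | app A B ihA ihB => simp [rename, FV, ihA, ihB, or_and_right, exists_or]

theorem mem_FV_subst (A : LTerm) (σ : ℕ → LTerm) (x : ℕ) :
    x ∈ (A.subst σ).FV ↔ ∃ y ∈ A.FV, x ∈ (σ y).FV := by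
  induction A generalizing σ x with
  | var y => simp [subst, FV]
  | lam a A ih =>
    change x + 1 ∈ (A.subst (liftSubst σ)).FV ↔ ∃ y, y + 1 ∈ A.FV ∧ x ∈ (σ y).FV
    rw [ih]
    constructor
    · rintro ⟨y, hy, h⟩
      cases y with
      | zero => simp [liftSubst, FV] at h
      | succ y =>
        obtain ⟨z, hz, hzx⟩ := (mem_FV_rename _ _ _).1 h
        exact ⟨y, hy, Nat.succ.inj hzx ▸ hz⟩
    · rintro ⟨y, hy, h⟩
      exact ⟨y + 1, hy, (mem_FV_rename _ _ _).2 ⟨x, h, rfl⟩⟩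
  | app A B ihA ihB =>
    simp [subst, FV, ihA, ihB, FV_shiftLabels, or_and_right, exists_or]

theorem FV_inst_subset (a : Label) (A B : LTerm) : (A.inst B).FV ⊆ (app (lam a A) B).FV := by
  intro x hx
  rw [inst_eq_subst, mem_FV_subst] at hx
  obtain ⟨y, hy, h⟩ := hx
  cases y with
  | zero => exact Or.inr h
  | succ y => exact Or.inl (by simp only [instMap, FV, Set.mem_singleton_iff] at h; exact h ▸ hy)

theorem Away.mono {A B : LTerm} {S : List ℕ} (h : A.Away S) (hAB : B.FV ⊆ A.FV) : B.Away S :=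
  fun x hx hB => h x hx (hAB hB)

theorem Away.subst {A : LTerm} {σ : ℕ → LTerm} {S T : List ℕ} (h : A.Away T)
    (hσ : ∀ x ∉ T, (σ x).Away S) : (A.subst σ).Away S := by
  intro s hs hsA
  obtain ⟨y, hy, hys⟩ := (mem_FV_subst _ _ _).1 hsA
  exact hσ y (fun hyT => h y hyT hy) s hs hys

theorem Away.rename {A : LTerm} {ρ : ℕ → ℕ} {S T : List ℕ} (h : A.Away T)
    (hρ : ∀ x ∉ T, ρ x ∉ S) : (A.rename ρ).Away S := by
  rw [rename_eq_subst]
  refine h.subst fun x hx s hs hsx => ?_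
  simp only [FV, Set.mem_singleton_iff] at hsx
  exact hρ x hx (hsx ▸ hs)

theorem away_liftSubst_consVar {σ : ℕ → LTerm} {S T : List ℕ} (hσ : ∀ x ∉ T, (σ x).Away S) :
    ∀ x ∉ consVar T, (liftSubst σ x).Away (consVar S) := by
  intro x hx
  cases x with
  | zero => simp at hx
  | succ x =>
    exact (hσ x (by simpa using hx)).rename fun y hy => by simpa using hy

theorem away_liftSubst_shiftVars {σ : ℕ → LTerm} {S T : List ℕ}
    (hσ : ∀ x ∉ T, (σ x).Away S) :
    ∀ x ∉ shiftVars T, (liftSubst σ x).Away (shiftVars S) := by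
  intro x hx
  cases x with
  | zero =>
    intro s hs h
    simp only [liftSubst, FV, Set.mem_singleton_iff] at h
    simp [h] at hs
  | succ x =>
    exact (hσ x (by simpa using hx)).rename fun y hy => by simpa using hy

theorem away_instMap {B : LTerm} {S : List ℕ} (hB : B.Away S) :
    ∀ x ∉ shiftVars S, (instMap B x).Away S := by
  intro x hx
  cases x with
  | zero => exact hB
  | succ x =>
    intro s hs h
    simp only [instMap, FV, Set.mem_singleton_iff] at h
    subst h
    simp [hs] at hx

theorem liftRen_notMem_consVar {ρ : ℕ → ℕ} {S T : List ℕ} (hρ : ∀ x ∉ T, ρ x ∉ S) :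
    ∀ x ∉ consVar T, liftRen ρ x ∉ consVar S := by
  intro x hx
  cases x with
  | zero => simp at hx
  | succ x => simpa [liftRen] using hρ x (by simpa using hx)

theorem liftRen_notMem_shiftVars {ρ : ℕ → ℕ} {S T : List ℕ} (hρ : ∀ x ∉ T, ρ x ∉ S) :
    ∀ x ∉ shiftVars T, liftRen ρ x ∉ shiftVars S := by
  intro x hx
  cases x with
  | zero => simp [liftRen]
  | succ x => simpa [liftRen] using hρ x (by simpa using hx)

/-! ### Congruence for reduction -/

theorem Step.beta {S : List ℕ} {A B : LTerm} (h : (app (lam (.idx 0) A) B).Away S) :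
    Step S (app (lam (.idx 0) A) B) (A.starLabel.inst B) :=
  Step.contract .hole A B h

theorem Step.lam {S : List ℕ} {A B : LTerm} (a : Label) (h : Step (consVar S) A B) :
    Step S (lam a A) (lam a B) := by
  obtain ⟨C, A, B, h⟩ := h
  exact Step.contract (.lam a C) A B h

theorem Step.appL {S : List ℕ} {A A' : LTerm} (B : LTerm) (h : Step S A A') :
    Step S (app A B) (app A' B) := by
  obtain ⟨C, A, A', h⟩ := h
  exact Step.contract (.appL C B) A A' h

theorem Step.appR {S : List ℕ} {B B' : LTerm} (A : LTerm) (h : Step S B B') :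
    Step S (app A B) (app A B') := by
  obtain ⟨C, B, B', h⟩ := h
  exact Step.contract (.appR A C) B B' h

theorem Steps.lam {S : List ℕ} {A B : LTerm} (a : Label) (h : Steps (consVar S) A B) :
    Steps S (lam a A) (lam a B) :=
  Relation.ReflTransGen.lift (LTerm.lam a) (fun _ _ => Step.lam a) _ _ h

theorem Steps.app {S : List ℕ} {A A' B B' : LTerm} (hA : Steps S A A') (hB : Steps S B B') :
    Steps S (app A B) (app A' B') :=
  Relation.ReflTransGen.trans
    (Relation.ReflTransGen.lift (LTerm.app · B) (fun _ _ => Step.appL B) _ _ hA)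
    (Relation.ReflTransGen.lift (LTerm.app A') (fun _ _ => Step.appR A') _ _ hB)

/-! ### Parallel reduction -/

/-- Parallel reduction: simultaneous contraction of some of the redexes of a term. -/
inductive Par : List ℕ → LTerm → LTerm → Prop
  | var (S : List ℕ) (x : ℕ) : Par S (var x) (var x)
  | lam {S : List ℕ} (a : Label) {A A' : LTerm} :
      Par (consVar S) A A' → Par S (lam a A) (lam a A')
  | app {S : List ℕ} {A A' B B' : LTerm} :
      Par S A A' → Par S B B' → Par S (app A B) (app A' B')
  | beta {S : List ℕ} {A A' B B' : LTerm} :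
      Par (consVar S) A A' → Par S B B' → (LTerm.app (.lam (.idx 0) A) B).Away S →
      Par S (.app (.lam (.idx 0) A) B) (A'.starLabel.inst B')

theorem Par.refl (S : List ℕ) (A : LTerm) : Par S A A := by
  induction A generalizing S with
  | var x => exact .var S x
  | lam a A ih => exact .lam a (ih _)
  | app A B ihA ihB => exact .app (ihA _) (ihB _)

theorem Step.par {S : List ℕ} {A B : LTerm} (h : Step S A B) : Par S A B := by
  obtain ⟨C, A, B, h⟩ := h
  induction C generalizing S with
  | hole => exact .beta (.refl _ _) (.refl _ _) h
  | lam a C ih => exact .lam a (ih h)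
  | appL C B ih => exact .app (ih h) (.refl _ _)
  | appR B C ih => exact .app (.refl _ _) (ih h)

theorem Par.FV_subset {S : List ℕ} {A B : LTerm} (h : Par S A B) : B.FV ⊆ A.FV := by
  induction h with
  | var S x => exact subset_rfl
  | lam a _ ih => exact fun x hx => ih hx
  | app _ _ ihA ihB => exact Set.union_subset_union ihA ihB
  | beta _ _ _ ihA ihB =>
    refine (FV_inst_subset .star _ _).trans (Set.union_subset_union (fun x hx => ?_) ihB)
    exact ihA (FV_starLabel _ ▸ (show x + 1 ∈ _ from hx))

theorem Par.away {S T : List ℕ} {A B : LTerm} (h : Par S A B) (hA : A.Away T) : B.Away T :=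
  hA.mono h.FV_subset

theorem Par.steps {S : List ℕ} {A B : LTerm} (h : Par S A B) : Steps S A B := by
  induction h with
  | var S x => exact .refl
  | lam a _ ih => exact ih.lam a
  | app _ _ ihA ihB => exact ihA.app ihB
  | beta hA hB h ihA ihB =>
    -- The inner reductions are done first; they create no free variables, so the redex is still
    -- away from `S` when it is contracted.
    exact ((ihA.lam _).app ihB).tail (.beta ((Par.app (.lam _ hA) hB).away h))

theorem steps_iff_reflTransGen_par {S : List ℕ} {A B : LTerm} :
    Steps S A B ↔ Relation.ReflTransGen (Par S) A B := by
  constructor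
  · intro h
    induction h with
    | refl => exact .refl
    | tail _ h ih => exact ih.tail h.par
  · intro h
    induction h with
    | refl => exact .refl
    | tail _ h ih => exact Relation.ReflTransGen.trans ih h.steps

theorem Steps.FV_subset {S : List ℕ} {A B : LTerm} (h : Steps S A B) : B.FV ⊆ A.FV := by
  induction h with
  | refl => exact subset_rfl
  | tail _ h ih => exact h.par.FV_subset.trans ih

theorem Par.rename {S T : List ℕ} {A A' : LTerm} {ρ : ℕ → ℕ} (h : Par T A A')
    (hρ : ∀ x ∉ T, ρ x ∉ S) : Par S (A.rename ρ) (A'.rename ρ) := by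
  induction h generalizing S ρ with
  | var T x => exact .var _ _
  | lam a _ ih => exact .lam a (ih (liftRen_notMem_consVar hρ))
  | app _ _ ihA ihB => exact .app (ihA hρ) (ihB hρ)
  | beta _ _ h ihA ihB =>
    rw [inst_starLabel_rename]
    exact .beta (ihA (liftRen_notMem_consVar hρ)) (ihB hρ) (h.rename hρ)

theorem Par.relabel {S : List ℕ} {A A' : LTerm} (g : ℕ → Label) (h : Par S A A') :
    Par S (A.relabel g) (A'.relabel g) := by
  induction h generalizing g with
  | var T x => exact .var _ _
  | lam a _ ih => exact .lam _ (ih g)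
  | app _ _ ihA ihB => exact .app (ihA _) (ihB _)
  | beta _ _ h ihA ihB =>
    rw [inst_starLabel_relabel]
    exact .beta (ihA _) (ihB _) (h.mono (FV_relabel (.app (.lam _ _) _) g).subset)

theorem Par.liftSubst {S : List ℕ} {σ τ : ℕ → LTerm} (h : ∀ x, Par S (σ x) (τ x)) (x : ℕ) :
    Par (consVar S) (LTerm.liftSubst σ x) (LTerm.liftSubst τ x) := by
  cases x with
  | zero => exact .var _ _
  | succ x => exact (h x).rename fun y hy => by simpa using hy

/-- A redex away from `T` has all its free variables outside `T`. By `ha` these are replaced by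
terms away from `S`, so the redex stays contractible. -/
theorem Par.subst {S T : List ℕ} {A A' : LTerm} {σ τ : ℕ → LTerm} (h : Par T A A')
    (hσ : ∀ x, Par S (σ x) (τ x)) (ha : ∀ x ∉ T, (σ x).Away S) :
    Par S (A.subst σ) (A'.subst τ) := by
  induction h generalizing S σ τ with
  | var T x => exact hσ x
  | lam a _ ih => exact .lam a (ih (Par.liftSubst hσ) (away_liftSubst_consVar ha))
  | app _ _ ihA ihB =>
    refine .app (ihA (fun x => (hσ x).relabel _) fun x hx => ?_) (ihB hσ ha)
    exact (ha x hx).mono (FV_shiftLabels _).subset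
  | beta _ _ h ihA ihB =>
    rw [inst_starLabel_subst]
    refine .beta (ihA (Par.liftSubst fun x => (hσ x).relabel _) (away_liftSubst_consVar
      fun x hx => (ha x hx).mono (FV_shiftLabels _).subset)) (ihB hσ ha) (h.subst ha)

theorem Par.inst_starLabel {S : List ℕ} {A A' B B' : LTerm} (hA : Par (consVar S) A A')
    (hB : Par S B B') (ha : (LTerm.app (.lam (.idx 0) A) B).Away S) :
    Par S (A.starLabel.inst B) (A'.starLabel.inst B') := by
  rw [inst_eq_subst, inst_eq_subst]
  refine (hA.relabel _).subst (fun x => ?_) fun x hx => away_instMap (fun s hs h => ?_) x ?_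
  · cases x with
    | zero => exact hB
    | succ x => exact .var _ _
  · exact ha s hs (Or.inr h)
  · cases x with
    | zero => simp
    | succ x => simpa using hx

/-! ### Confluence and uniqueness of normal forms -/

/-- A redex survives any parallel step inside it: its abstraction keeps its label, and its free
variables can only decrease, so the side condition persists. A branch that did not contract it can
therefore still do so, and `Par.inst_starLabel` closes the other branch. -/
theorem Par.diamond {S : List ℕ} {A B C : LTerm} (hB : Par S A B) (hC : Par S A C) :
    ∃ D, Par S B D ∧ Par S C D := by
  induction hB generalizing C with
  | var S x => exact ⟨C, hC, .refl _ _⟩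
  | lam a _ ih =>
    cases hC with
    | lam _ hC =>
      obtain ⟨D, h₁, h₂⟩ := ih hC
      exact ⟨_, .lam a h₁, .lam a h₂⟩
  | app hA hB ihA ihB =>
    cases hC with
    | app hA' hB' =>
      obtain ⟨D, h₁, h₂⟩ := ihA hA'
      obtain ⟨E, h₃, h₄⟩ := ihB hB'
      exact ⟨_, .app h₁ h₃, .app h₂ h₄⟩
    | beta hA' hB' h =>
      obtain ⟨D, h₁, h₂⟩ := ihA (.lam _ hA')
      obtain ⟨E, h₃, h₄⟩ := ihB hB'
      have ha' := (Par.app (.lam _ hA') hB').away h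
      have ha := (Par.app hA hB).away h
      cases hA with
      | lam _ hA =>
        cases h₁ with
        | lam _ h₁ =>
          cases h₂ with
          | lam _ h₂ => exact ⟨_, .beta h₁ h₃ ha, h₂.inst_starLabel h₄ ha'⟩
  | beta hA hB h ihA ihB =>
    have ha := (Par.app (.lam _ hA) hB).away h
    cases hC with
    | app hA' hB' =>
      have ha' := (Par.app hA' hB').away h
      cases hA' with
      | lam _ hA' =>
        obtain ⟨D, h₁, h₂⟩ := ihA hA'
        obtain ⟨E, h₃, h₄⟩ := ihB hB'
        exact ⟨_, h₁.inst_starLabel h₃ ha, .beta h₂ h₄ ha'⟩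
    | beta hA' hB' =>
      have ha' := (Par.app (.lam _ hA') hB').away h
      obtain ⟨D, h₁, h₂⟩ := ihA hA'
      obtain ⟨E, h₃, h₄⟩ := ihB hB'
      exact ⟨_, h₁.inst_starLabel h₃ ha, h₂.inst_starLabel h₄ ha'⟩

theorem IsNormal.eq_of_steps {S : List ℕ} {A B : LTerm} (hA : IsNormal S A)
    (h : Steps S A B) : A = B := by
  obtain h | ⟨C, h, _⟩ := Relation.ReflTransGen.cases_head h
  · exact h
  · exact (hA C h).elim

theorem Steps.normal_unique {S : List ℕ} {A B C : LTerm} (hB : Steps S A B) (hC : Steps S A C)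
    (nB : IsNormal S B) (nC : IsNormal S C) : B = C := by
  have key : ∀ A B C, Par S A B → Par S A C →
      ∃ D, Relation.ReflGen (Par S) B D ∧ Relation.ReflTransGen (Par S) C D := by
    intro A B C h₁ h₂
    obtain ⟨D, h₃, h₄⟩ := Par.diamond h₁ h₂
    exact ⟨D, .single h₃, .single h₄⟩
  obtain ⟨D, h₁, h₂⟩ := Relation.church_rosser key
    (steps_iff_reflTransGen_par.1 hB) (steps_iff_reflTransGen_par.1 hC)
  exact (nB.eq_of_steps (steps_iff_reflTransGen_par.2 h₁)).trans
    (nC.eq_of_steps (steps_iff_reflTransGen_par.2 h₂)).symm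

/-! ### Reduction and substitution -/

theorem Steps.rename {S T : List ℕ} {A B : LTerm} {ρ : ℕ → ℕ} (h : Steps T A B)
    (hρ : ∀ x ∉ T, ρ x ∉ S) : Steps S (A.rename ρ) (B.rename ρ) := by
  induction h with
  | refl => exact .refl
  | tail _ h ih => exact Relation.ReflTransGen.trans ih (h.par.rename hρ).steps

theorem Steps.relabel {S : List ℕ} {A B : LTerm} (g : ℕ → Label) (h : Steps S A B) :
    Steps S (A.relabel g) (B.relabel g) := by
  induction h with
  | refl => exact .refl
  | tail _ h ih => exact Relation.ReflTransGen.trans ih (h.par.relabel g).steps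

theorem Steps.subst_left {S T : List ℕ} {A B : LTerm} {σ : ℕ → LTerm} (h : Steps T A B)
    (ha : ∀ x ∉ T, (σ x).Away S) : Steps S (A.subst σ) (B.subst σ) := by
  induction h with
  | refl => exact .refl
  | tail _ h ih =>
    exact Relation.ReflTransGen.trans ih (h.par.subst (fun x => .refl _ _) ha).steps

theorem Steps.subst_right {S : List ℕ} (A : LTerm) {σ τ : ℕ → LTerm}
    (h : ∀ x, Steps S (σ x) (τ x)) : Steps S (A.subst σ) (A.subst τ) := by
  induction A generalizing S σ τ with
  | var x => exact h x
  | lam a A ih =>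
    refine (ih fun x => ?_).lam a
    cases x with
    | zero => exact .refl
    | succ x => exact (h x).rename fun y hy => by simpa using hy
  | app A B ihA ihB => exact (ihA fun x => (h x).relabel _).app (ihB h)

/-- `HeadSteps S k A B`: the term `A` reduces to `B` once its first `k` abstractions, which are
exposed one after the other, have been consumed by applications binding the labels `0, …, k - 1`;
these abstractions remain in `B`, with label `⋆`. -/
def HeadSteps : List ℕ → ℕ → LTerm → LTerm → Prop
  | S, 0, A, B => Steps S A B
  | S, k + 1, A, B => ∃ A' B', Steps S A (lam (.idx 0) A') ∧
      HeadSteps (shiftVars S) k A'.starLabel B' ∧ B = lam .star B'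

theorem HeadSteps.head {S : List ℕ} {k : ℕ} {A A' B : LTerm} (h : Steps S A A')
    (h' : HeadSteps S k A' B) : HeadSteps S k A B := by
  cases k with
  | zero => exact Relation.ReflTransGen.trans h h'
  | succ k =>
    obtain ⟨A₁, B', h₁, h₂, rfl⟩ := h'
    exact ⟨A₁, B', Relation.ReflTransGen.trans h h₁, h₂, rfl⟩

theorem HeadSteps.FV_subset {S : List ℕ} {k : ℕ} {A B : LTerm} (h : HeadSteps S k A B) :
    B.FV ⊆ A.FV := by
  induction k generalizing S A B with
  | zero => exact Steps.FV_subset h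
  | succ k ih =>
    obtain ⟨A', B', h₁, h₂, rfl⟩ := h
    refine Set.Subset.trans (fun x hx => ?_) h₁.FV_subset
    exact (FV_starLabel A').subset (ih h₂ hx)

theorem HeadSteps.rename {S T : List ℕ} {k : ℕ} {A B : LTerm} {ρ : ℕ → ℕ}
    (h : HeadSteps T k A B) (hρ : ∀ x ∉ T, ρ x ∉ S) :
    HeadSteps S k (A.rename ρ) (B.rename ρ) := by
  induction k generalizing S T A B ρ with
  | zero => exact Steps.rename h hρ
  | succ k ih =>
    obtain ⟨A', B', h₁, h₂, rfl⟩ := h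
    refine ⟨A'.rename (liftRen ρ), B'.rename (liftRen ρ), h₁.rename hρ, ?_, rfl⟩
    rw [starLabel_rename]
    exact ih h₂ (liftRen_notMem_shiftVars hρ)

/-- Consuming an abstraction removes one label scope and turns that label into `⋆`. After `n` of
them, the copies of `σ x` have become `starLabel^[n] (σ x)`, and only then are they reduced. -/
theorem HeadSteps.subst {S T : List ℕ} {n : ℕ} {A C : LTerm} {σ τ : ℕ → LTerm}
    (h : HeadSteps T n A C) (hσ : ∀ x, Steps S (starLabel^[n] (σ x)) (τ x))
    (ha : ∀ x ∉ T, (σ x).Away S) : HeadSteps S n (A.subst σ) (C.subst τ) := by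
  induction n generalizing S T A C σ τ with
  | zero => exact Relation.ReflTransGen.trans (Steps.subst_left h ha) (Steps.subst_right C hσ)
  | succ n ih =>
    obtain ⟨A', C', h₁, h₂, rfl⟩ := h
    refine ⟨A'.subst (liftSubst σ), C'.subst (liftSubst τ), h₁.subst_left ha, ?_, rfl⟩
    rw [subst_starLabel]
    refine ih h₂ (fun x => ?_) fun x hx =>
      (away_liftSubst_shiftVars ha x hx).mono (FV_starLabel _).subset
    rw [← Function.iterate_succ_apply]
    cases x with
    | zero => rw [liftSubst, starLabel_iterate_var]; exact .refl
    | succ x =>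
      rw [liftSubst, starLabel_iterate_rename]
      exact (hσ x).rename fun y hy => by simpa using hy

/-- If below its `n` abstractions `C` is just the variable `y` of the outer scope (index `n + y`),
then the term substituted for `y` comes to the head, and its own `m` consumed abstractions follow
the first `n`. This is what the shape condition in `app2` is for. The index `y` is general because
the induction shifts it at each abstraction. -/
theorem HeadSteps.subst_head {S T : List ℕ} {n m y : ℕ} {A C : LTerm} {σ τ : ℕ → LTerm}
    (h : HeadSteps T n A C) (hC : C.erase = Term.lam^[n] (.var (n + y)))
    (hσ : HeadSteps S m (starLabel^[n] (σ y)) (τ y)) (ha : ∀ x ∉ T, (σ x).Away S) :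
    HeadSteps S (n + m) (A.subst σ) (C.subst τ) := by
  induction n generalizing S T A C σ τ y with
  | zero =>
    have hCy : C = .var y := by
      cases C with
      | var x => simpa [erase] using hC
      | lam a C => simp [erase] at hC
      | app C D => simp [erase] at hC
    subst hCy
    rw [Nat.zero_add]
    exact .head (Steps.subst_left h ha) hσ
  | succ n ih =>
    obtain ⟨A', C', h₁, h₂, rfl⟩ := h
    rw [Nat.succ_add]
    refine ⟨A'.subst (liftSubst σ), C'.subst (liftSubst τ), h₁.subst_left ha, ?_, rfl⟩
    rw [subst_starLabel]
    rw [Function.iterate_succ_apply', erase, Term.lam.injEq] at hC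
    refine ih (y := y + 1) h₂ (by rw [hC]; congr 2; omega) ?_ fun x hx =>
      (away_liftSubst_shiftVars ha x hx).mono (FV_starLabel _).subset
    rw [← Function.iterate_succ_apply, liftSubst, starLabel_iterate_rename]
    exact hσ.rename fun y hy => by simpa using hy

/-! ### Labeled supersteps -/

/-- The superstep judgement on labeled terms. In `Eval S k A B`, the applications that are to
consume the first `k` abstractions of `B` bind the labels `0, …, k - 1` of `A`; in `B` these
labels have been replaced by `⋆`. -/
inductive Eval : List ℕ → ℕ → LTerm → LTerm → Prop
  | var (S : List ℕ) (x : ℕ) : Eval S 0 (.var x) (.var x)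
  | abs1 {S : List ℕ} (a : Label) {A A' : LTerm} :
      Eval (consVar S) 0 A A' → Eval S 0 (.lam a A) (.lam a A')
  | abs2 {S : List ℕ} {k : ℕ} {A A' : LTerm} :
      Eval (shiftVars S) k A.starLabel A' →
      Eval S (k + 1) (.lam (.idx 0) A) (.lam .star A')
  | app1 {S : List ℕ} {A A' B B' : LTerm} :
      Eval S 0 A A' → Eval S 0 B B' → Eval S 0 (.app A B) (.app A' B')
  | app2 {S : List ℕ} {n m : ℕ} {A B D : LTerm} {a : Label} {C : LTerm} :
      Eval S (n + 1) A (.lam a C) → Eval S m (starLabel^[n] B) D →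
      (LTerm.app (.lam a C) D).Away S →
      (0 < m → C.erase = Term.lam^[n] (.var n)) →
      Eval S (n + m) (.app A B) (C.inst D)

theorem Eval.superstep {S : List ℕ} {k : ℕ} {A B : LTerm} (h : Eval S k A B) :
    Superstep S k A.erase B.erase := by
  induction h with
  | var S x => exact .var S x
  | abs1 a _ ih => exact .abs1 ih
  | abs2 _ ih => exact .abs2 (by rwa [starLabel, erase_relabel] at ih)
  | app1 _ _ ihA ihB => exact .app1 ihA ihB
  | app2 _ _ ha hC ihA ihB =>
    rw [erase_iterate_starLabel] at ihB
    rw [erase_inst]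
    exact .app2 ihA ihB ((away_erase _ _).2 ha) hC

theorem _root_.WeakLambda.Superstep.exists_eval {S : List ℕ} {k : ℕ} {M N : Term}
    (h : Superstep S k M N) : ∃ A B : LTerm, A.erase = M ∧ B.erase = N ∧ Eval S k A B := by
  induction h with
  | var S x => exact ⟨.var x, .var x, rfl, rfl, .var S x⟩
  | abs1 _ ih =>
    obtain ⟨A, B, rfl, rfl, h⟩ := ih
    exact ⟨.lam .star A, .lam .star B, rfl, rfl, .abs1 _ h⟩
  | abs2 _ ih =>
    obtain ⟨A, B, rfl, rfl, h⟩ := ih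
    -- The shift frees the label `0` for this abstraction alone; the evaluation of the body starts
    -- by removing it again.
    refine ⟨.lam (.idx 0) A.shiftLabels, .lam .star B, ?_, rfl, .abs2 ?_⟩
    · rw [erase, shiftLabels, erase_relabel]
    · rwa [starLabel_shiftLabels]
  | app1 _ _ ihA ihB =>
    obtain ⟨A, A', rfl, rfl, hA⟩ := ihA
    obtain ⟨B, B', rfl, rfl, hB⟩ := ihB
    exact ⟨.app A B, .app A' B', rfl, rfl, .app1 hA hB⟩
  | @app2 S n m M M' N N' _ _ ha hC ihA ihB =>
    obtain ⟨A, A', rfl, hA', hA⟩ := ihA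
    obtain ⟨B, B', rfl, rfl, hB⟩ := ihB
    cases A' with
    | var x => cases hA'
    | app C D => cases hA'
    | lam a C =>
      cases hA'
      -- The first `n` outer labels belong to the abstractions left over from the function, so the
      -- labels of the argument start after them.
      refine ⟨.app A (shiftLabels^[n] B), C.inst B', ?_, erase_inst _ _, .app2 hA ?_ ?_ hC⟩
      · rw [erase, erase_iterate_shiftLabels]
      · rwa [starLabel_iterate_shiftLabels_iterate]
      · exact (away_erase (.app (.lam a C) B') _).1 ha

/-- Only contraction could erase a variable, and contracted redexes contain no variable of `S`.
Consequently the side condition of `app2`, stated for the evaluated redex, already holds before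
evaluation, when reduction contracts it. -/
theorem Eval.mem_FV {S : List ℕ} {k : ℕ} {A B : LTerm} (h : Eval S k A B) {s : ℕ} (hs : s ∈ S)
    (hA : s ∈ A.FV) : s ∈ B.FV := by
  induction h generalizing s with
  | var S x => exact hA
  | abs1 a _ ih => exact ih (by simpa using hs) hA
  | abs2 _ ih => exact ih (by simpa using hs) ((FV_starLabel _).superset hA)
  | app1 _ _ ihA ihB => exact hA.imp (ihA hs) (ihB hs)
  | app2 _ _ ha _ ihA ihB =>
    refine (ha s hs (hA.imp (ihA hs) fun h => ihB hs ?_)).elim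
    rwa [FV_iterate_starLabel]

theorem Eval.away_of_away {S : List ℕ} {k : ℕ} {A B : LTerm} (h : Eval S k A B)
    (hB : B.Away S) : A.Away S :=
  fun s hs hA => hB s hs (h.mem_FV hs hA)

theorem Eval.headSteps {S : List ℕ} {k : ℕ} {A B : LTerm} (h : Eval S k A B) :
    HeadSteps S k A B := by
  induction h with
  | var S x => exact Relation.ReflTransGen.refl
  | abs1 a _ ih => exact Steps.lam a ih
  | abs2 _ ih => exact ⟨_, _, .refl, ih, rfl⟩
  | app1 _ _ ihA ihB => exact Steps.app ihA ihB
  | @app2 S n m A B D a C hA hB ha hC ihA ihB =>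
    have haA : A.Away S := hA.away_of_away fun s hs h => ha s hs (Or.inl h)
    have haB : B.Away S := (hB.away_of_away fun s hs h => ha s hs (Or.inr h)).mono
      (FV_iterate_starLabel _ _).superset
    obtain ⟨A', C', h₁, h₂, hCC'⟩ := ihA
    cases hCC'
    have haA' := haA.mono h₁.FV_subset
    -- Contract with the unevaluated argument `B`; the body and the copies of `B` are evaluated
    -- afterwards, no longer below the abstraction.
    refine .head (Relation.ReflTransGen.tail (h₁.app .refl)
      (.beta fun s hs h => h.elim (haA' s hs) (haB s hs))) ?_
    rw [inst_eq_subst, inst_eq_subst]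
    rcases Nat.eq_zero_or_pos m with rfl | hm
    · refine h₂.subst (fun x => ?_) (away_instMap haB)
      cases x with
      | zero => exact ihB
      | succ x => rw [instMap, starLabel_iterate_var]; exact .refl
    · exact h₂.subst_head (y := 0) (hC hm) ihB (away_instMap haB)

/-! ### Normal forms -/

theorem isNormal_var (S : List ℕ) (x : ℕ) : IsNormal S (var x) := by
  intro B h
  generalize hA : var x = A at h
  obtain ⟨C, A, B, h⟩ := h
  cases C <;> cases hA

theorem isNormal_lam {S : List ℕ} {a : Label} {A : LTerm} :
    IsNormal S (lam a A) ↔ IsNormal (consVar S) A := by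
  refine ⟨fun h B hB => h _ (hB.lam a), fun h B hB => ?_⟩
  generalize hA : lam a A = A' at hB
  obtain ⟨C, A', B, hB⟩ := hB
  cases C with
  | lam b C => cases hA; exact h _ (.contract C A' B hB)
  | _ => cases hA

theorem isNormal_app {S : List ℕ} {A B : LTerm} :
    IsNormal S (app A B) ↔ IsNormal S A ∧ IsNormal S B ∧
      ((app A B).Away S → ∀ A', A ≠ lam (.idx 0) A') := by
  refine ⟨fun h => ⟨fun C hC => h _ (hC.appL B), fun C hC => h _ (hC.appR A), ?_⟩, ?_⟩
  · rintro ha A' rfl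
    exact h _ (.beta ha)
  · rintro ⟨hA, hB, h⟩ D hD
    generalize hAB : app A B = A' at hD
    obtain ⟨C, A', B', hD⟩ := hD
    cases C with
    | hole => cases hAB; exact h hD _ rfl
    | lam b C => cases hAB
    | appL C E => cases hAB; exact hA _ (.contract C A' B' hD)
    | appR E C => cases hAB; exact hB _ (.contract C A' B' hD)

/-- `liftLabel g` sends no label other than `0` to `0`, so relabeling cannot turn an application
into a redex. -/
theorem relabel_liftLabel_ne {A : LTerm} (g : ℕ → Label) (h : ∀ A', A ≠ lam (.idx 0) A')
    (A' : LTerm) : A.relabel (liftLabel g) ≠ lam (.idx 0) A' := by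
  cases A with
  | var x => exact LTerm.noConfusion
  | app A B => exact LTerm.noConfusion
  | lam a A =>
    intro h'
    cases a with
    | star => cases h'
    | idx b =>
      cases b with
      | zero => exact h A rfl
      | succ b =>
        rw [relabel, lam.injEq] at h'
        have h₁ := h'.1
        simp only [Label.map, liftLabel] at h₁
        cases hg : g b <;> simp [hg] at h₁

theorem shiftLabels_ne (A A' : LTerm) : A.shiftLabels ≠ lam (.idx 0) A' := by
  cases A with
  | var x => exact LTerm.noConfusion
  | app A B => exact LTerm.noConfusion
  | lam a A => cases a <;> simp [shiftLabels, relabel, Label.map]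

theorem IsNormal.relabel {S : List ℕ} {A : LTerm} (g : ℕ → Label) (h : IsNormal S A) :
    IsNormal S (A.relabel g) := by
  induction A generalizing S g with
  | var x => exact isNormal_var _ _
  | lam a A ih => exact isNormal_lam.2 (ih g (isNormal_lam.1 h))
  | app A B ihA ihB =>
    obtain ⟨hA, hB, h⟩ := isNormal_app.1 h
    refine isNormal_app.2 ⟨ihA _ hA, ihB _ hB, fun ha => relabel_liftLabel_ne g (h ?_)⟩
    exact ha.mono (FV_relabel (.app A B) g).superset

theorem rename_ne {A : LTerm} {a : Label} (ρ : ℕ → ℕ) (h : ∀ A', A ≠ lam a A') (A' : LTerm) :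
    A.rename ρ ≠ lam a A' := by
  cases A with
  | var x => exact LTerm.noConfusion
  | app A B => exact LTerm.noConfusion
  | lam b A =>
    intro h'
    cases h'
    exact h A rfl

theorem Away.of_subst {S T : List ℕ} {A : LTerm} {σ : ℕ → LTerm} (h : (A.subst σ).Away S)
    (hσ : ∀ x ∈ T, ∃ s ∈ S, s ∈ (σ x).FV) : A.Away T := by
  intro x hx hA
  obtain ⟨s, hs, hsx⟩ := hσ x hx
  exact h s hs ((mem_FV_subst _ _ _).2 ⟨x, hA, hsx⟩)

theorem exists_mem_consVar_liftSubst {S T : List ℕ} {σ : ℕ → LTerm}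
    (hσ : ∀ x ∈ T, ∃ s ∈ S, s ∈ (σ x).FV) :
    ∀ x ∈ consVar T, ∃ s ∈ consVar S, s ∈ (liftSubst σ x).FV := by
  intro x hx
  cases x with
  | zero => exact ⟨0, by simp, rfl⟩
  | succ x =>
    obtain ⟨s, hs, h⟩ := hσ x (by simpa using hx)
    exact ⟨s + 1, by simpa using hs, (mem_FV_rename _ _ _).2 ⟨s, h, rfl⟩⟩

theorem exists_mem_shiftVars_liftSubst {S T : List ℕ} {σ : ℕ → LTerm}
    (hσ : ∀ x ∈ T, ∃ s ∈ S, s ∈ (σ x).FV) :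
    ∀ x ∈ shiftVars T, ∃ s ∈ shiftVars S, s ∈ (liftSubst σ x).FV := by
  intro x hx
  cases x with
  | zero => simp at hx
  | succ x =>
    obtain ⟨s, hs, h⟩ := hσ x (by simpa using hx)
    exact ⟨s + 1, by simpa using hs, (mem_FV_rename _ _ _).2 ⟨s, h, rfl⟩⟩

theorem exists_mem_instMap (B : LTerm) (S : List ℕ) :
    ∀ x ∈ shiftVars S, ∃ s ∈ S, s ∈ (instMap B x).FV := by
  intro x hx
  cases x with
  | zero => simp at hx
  | succ x => exact ⟨x, by simpa using hx, rfl⟩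

theorem IsNormal.rename {S T : List ℕ} {A : LTerm} {ρ : ℕ → ℕ} (h : IsNormal T A)
    (hρ : ∀ x ∈ T, ρ x ∈ S) : IsNormal S (A.rename ρ) := by
  induction A generalizing S T ρ with
  | var x => exact isNormal_var _ _
  | lam a A ih =>
    refine isNormal_lam.2 (ih (isNormal_lam.1 h) fun x hx => ?_)
    cases x with
    | zero => simp [liftRen]
    | succ x => simpa [liftRen] using hρ x (by simpa using hx)
  | app A B ihA ihB =>
    obtain ⟨hA, hB, h⟩ := isNormal_app.1 h
    refine isNormal_app.2 ⟨ihA hA hρ, ihB hB hρ, fun ha => rename_ne ρ (h ?_)⟩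
    change ((LTerm.app A B).rename ρ).Away S at ha
    rw [rename_eq_subst] at ha
    exact ha.of_subst fun x hx => ⟨ρ x, hρ x hx, rfl⟩

theorem IsNormal.liftSubst {S S' : List ℕ} {σ : ℕ → LTerm} (h : ∀ x, IsNormal S (σ x))
    (hS : ∀ x ∈ S, x + 1 ∈ S') (x : ℕ) : IsNormal S' (LTerm.liftSubst σ x) := by
  cases x with
  | zero => exact isNormal_var _ _
  | succ x => exact (h x).rename hS

/-- Substituted terms are shifted past bound labels, so no abstraction they bring in matches an
application of `A`. A redex blocked by a variable of `T` stays blocked, because by `hb` the image of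
that variable contains a variable of `S`. -/
theorem IsNormal.subst {S T : List ℕ} {A : LTerm} {σ : ℕ → LTerm} (h : IsNormal T A)
    (hσ : ∀ x, IsNormal S (σ x)) (hb : ∀ x ∈ T, ∃ s ∈ S, s ∈ (σ x).FV) :
    IsNormal S (A.subst σ) := by
  induction A generalizing S T σ with
  | var x => exact hσ x
  | lam a A ih =>
    exact isNormal_lam.2 (ih (isNormal_lam.1 h) (IsNormal.liftSubst hσ (by simp))
      (exists_mem_consVar_liftSubst hb))
  | app A B ihA ihB =>
    obtain ⟨hA, hB, h⟩ := isNormal_app.1 h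
    refine isNormal_app.2 ⟨ihA hA (fun x => (hσ x).relabel _) ?_, ihB hB hσ hb, ?_⟩
    · simpa only [FV_shiftLabels] using hb
    · intro ha A' hA'
      cases A with
      | var x => exact shiftLabels_ne _ _ hA'
      | app A₁ A₂ => cases hA'
      | lam a A =>
        cases hA'
        exact h (ha.of_subst (A := .app (.lam (.idx 0) A) B) hb) A rfl

/-- `NormalUnder S k p B`: the term `B` starts with `k` abstractions labeled `⋆`, and the term
below them is normal; if `p` holds, it is not an abstraction labeled `0`. -/
def NormalUnder : List ℕ → ℕ → Prop → LTerm → Prop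
  | S, 0, p, B => IsNormal S B ∧ (p → ∀ B', B ≠ lam (.idx 0) B')
  | S, k + 1, p, B => ∃ B', B = lam .star B' ∧ NormalUnder (shiftVars S) k p B'

theorem NormalUnder.rename {S T : List ℕ} {k : ℕ} {p : Prop} {B : LTerm} {ρ : ℕ → ℕ}
    (h : NormalUnder T k p B) (hρ : ∀ x ∈ T, ρ x ∈ S) : NormalUnder S k p (B.rename ρ) := by
  induction k generalizing S T B ρ with
  | zero => exact ⟨h.1.rename hρ, fun hp => rename_ne ρ (h.2 hp)⟩
  | succ k ih =>
    obtain ⟨B', rfl, h⟩ := h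
    refine ⟨B'.rename (liftRen ρ), rfl, ih h fun x hx => ?_⟩
    cases x with
    | zero => simp at hx
    | succ x => simpa [liftRen] using hρ x (by simpa using hx)

/-- Below the `n` abstractions, substitution can produce a new abstraction labeled `0` only when the
term there is a variable; `hp` excludes this. -/
theorem NormalUnder.subst {S T : List ℕ} {n : ℕ} {p : Prop} {C : LTerm} {σ : ℕ → LTerm}
    (h : NormalUnder T n p C) (hσ : ∀ x, IsNormal S (σ x))
    (hb : ∀ x ∈ T, ∃ s ∈ S, s ∈ (σ x).FV)
    (hp : p → ∀ y, C.erase = Term.lam^[n] (.var (n + y)) → ∀ B', σ y ≠ lam (.idx 0) B') :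
    NormalUnder S n p (C.subst σ) := by
  induction n generalizing S T C σ with
  | zero =>
    refine ⟨h.1.subst hσ hb, fun h₀ B' hB' => ?_⟩
    cases C with
    | var x => exact hp h₀ x (by simp [erase]) B' hB'
    | app A B => cases hB'
    | lam a A =>
      cases hB'
      exact h.2 h₀ A rfl
  | succ n ih =>
    obtain ⟨C', rfl, h⟩ := h
    refine ⟨C'.subst (liftSubst σ), rfl, ih h (IsNormal.liftSubst hσ (by simp))
      (exists_mem_shiftVars_liftSubst hb) fun h₀ y hy => ?_⟩
    cases y with
    | zero => exact fun _ => LTerm.noConfusion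
    | succ y =>
      refine rename_ne _ (hp h₀ y ?_)
      rw [erase, hy, Function.iterate_succ_apply']
      congr 3
      omega

theorem NormalUnder.subst_head {S T : List ℕ} {n m y : ℕ} {p q : Prop} {C : LTerm}
    {σ : ℕ → LTerm} (h : NormalUnder T n q C) (hC : C.erase = Term.lam^[n] (.var (n + y)))
    (hσ : NormalUnder S m p (σ y)) : NormalUnder S (n + m) p (C.subst σ) := by
  induction n generalizing S T C σ y with
  | zero =>
    cases C with
    | var x =>
      have hx : x = y := by simpa [erase] using hC
      subst hx
      rwa [Nat.zero_add]
    | app A B => simp [erase] at hC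
    | lam a A => simp [erase] at hC
  | succ n ih =>
    obtain ⟨C', rfl, h⟩ := h
    rw [Function.iterate_succ_apply', erase, Term.lam.injEq] at hC
    rw [Nat.succ_add]
    refine ⟨C'.subst (liftSubst σ), rfl,
      ih (y := y + 1) h (by rw [hC]; congr 2; omega) ?_⟩
    exact hσ.rename (by simp)

/-! ### Evaluation to normal form -/

/-- Here `r` is the number of enclosing applications waiting for an abstraction, `k` of which are
served while `j` are left over. The induction is on the erasure because evaluation recurs on terms
such as `A.starLabel`, which are subterms only up to labels. -/
theorem exists_eval_normal (M : Term) : ∀ (A : LTerm), A.erase = M → ∀ (S : List ℕ) (r : ℕ),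
    (r = 0 ∨ A.Away S) →
    ∃ k j B, r = k + j ∧ Eval S k A B ∧ NormalUnder S k (0 < j) B := by
  induction M with
  | var x =>
    rintro (y | _ | _) hA S r -
    · exact ⟨0, r, .var y, (Nat.zero_add r).symm, .var S y, isNormal_var S y,
        fun _ _ => LTerm.noConfusion⟩
    · cases hA
    · cases hA
  | lam M ih =>
    rintro (_ | ⟨a, A⟩ | _) hA S r hr
    · cases hA
    · cases hA
      -- An abstraction is consumed exactly when an application is waiting and the label is that of
      -- the nearest one. Otherwise its variable joins the binding path and nothing waits for the
      -- body.
      by_cases h : 0 < r ∧ a = .idx 0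
      · obtain ⟨hr₀, rfl⟩ := h
        obtain ⟨r, rfl⟩ := Nat.exists_eq_add_of_lt hr₀
        have ha : (LTerm.lam (.idx 0) A).Away S := hr.resolve_left (by omega)
        obtain ⟨k, j, B, hk, hB, hn⟩ := ih A.starLabel (erase_relabel _ _) (shiftVars S) r
          (Or.inr fun s hs h => by
            rw [FV_starLabel] at h
            cases s with
            | zero => simp at hs
            | succ s => exact ha s (by simpa using hs) h)
        exact ⟨k + 1, j, _, by omega, .abs2 hB, B, rfl, hn⟩
      · obtain ⟨k, j, B, hk, hB, hn⟩ := ih A rfl (consVar S) 0 (Or.inl rfl)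
        obtain ⟨rfl, rfl⟩ := Nat.add_eq_zero_iff.1 hk.symm
        refine ⟨0, r, _, (Nat.zero_add r).symm, .abs1 a hB, isNormal_lam.2 hn.1, ?_⟩
        intro hr₀ B' hB'
        cases hB'
        exact h ⟨hr₀, rfl⟩
    · cases hA
  | app M N ihM ihN =>
    rintro (_ | _ | ⟨A, B⟩) hA S r hr
    · cases hA
    · cases hA
    cases hA
    by_cases ha : (LTerm.app A B).Away S
    · have haA : A.Away S := fun s hs h => ha s hs (Or.inl h)
      have haB : B.Away S := fun s hs h => ha s hs (Or.inr h)
      -- The application itself waits for an abstraction from `A`, in front of the `r` outer ones.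
      obtain ⟨k, j, A', hk, hA', nA'⟩ := ihM A rfl S (r + 1) (Or.inr haA)
      cases k with
      | zero =>
        obtain ⟨k, j', B', hk', hB', nB'⟩ := ihN B rfl S 0 (Or.inl rfl)
        obtain ⟨rfl, rfl⟩ := Nat.add_eq_zero_iff.1 hk'.symm
        -- None of the `r + 1` waiting applications was served, so `j > 0` and `A'` does not form a
        -- redex with this application.
        exact ⟨0, r, _, (Nat.zero_add r).symm, .app1 hA' hB',
          isNormal_app.2 ⟨nA'.1, nB'.1, fun _ => nA'.2 (by omega)⟩, fun _ _ => LTerm.noConfusion⟩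
      | succ n =>
        obtain ⟨C, rfl, nC⟩ := nA'
        have haC := haA.mono hA'.headSteps.FV_subset
        have haB' : (starLabel^[n] B).Away S := haB.mono (FV_iterate_starLabel _ _).subset
        have he := erase_iterate_starLabel n B
        -- In this shape the argument comes to the head of the result, so the `j` unserved
        -- applications are passed on to it. Otherwise it cannot serve them and is evaluated with
        -- none waiting.
        by_cases hC : C.erase = Term.lam^[n] (.var n)
        · obtain ⟨m, j', D, hm, hD, nD⟩ := ihN _ he S j (Or.inr haB')
          have haD := haB'.mono hD.headSteps.FV_subset
          refine ⟨n + m, j', _, by omega,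
            .app2 hA' hD (fun s hs h => h.elim (haC s hs) (haD s hs)) fun _ => hC, ?_⟩
          rw [inst_eq_subst]
          exact nC.subst_head (y := 0) hC nD
        · obtain ⟨m, j', D, hm, hD, nD⟩ := ihN _ he S 0 (Or.inl rfl)
          obtain ⟨rfl, rfl⟩ := Nat.add_eq_zero_iff.1 hm.symm
          have haD := haB'.mono hD.headSteps.FV_subset
          refine ⟨n, j, _, by omega,
            .app2 hA' hD (fun s hs h => h.elim (haC s hs) (haD s hs)) fun h => by omega, ?_⟩
          rw [inst_eq_subst]
          refine nC.subst (fun x => ?_) (exists_mem_instMap D S) fun _ y hy => ?_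
          · cases x with
            | zero => exact nD.1
            | succ x => exact isNormal_var _ _
          · cases y with
            | zero => exact (hC hy).elim
            | succ y => exact fun _ => LTerm.noConfusion
    · obtain rfl := hr.resolve_right ha
      obtain ⟨k, j, A', hk, hA', nA'⟩ := ihM A rfl S 0 (Or.inl rfl)
      obtain ⟨rfl, rfl⟩ := Nat.add_eq_zero_iff.1 hk.symm
      obtain ⟨k, j, B', hk, hB', nB'⟩ := ihN B rfl S 0 (Or.inl rfl)
      obtain ⟨rfl, rfl⟩ := Nat.add_eq_zero_iff.1 hk.symm
      -- The variable of `S` blocking the application is still free after evaluation, so the result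
      -- is blocked too.
      have h := Eval.app1 hA' hB'
      exact ⟨0, 0, _, rfl, h, isNormal_app.2 ⟨nA'.1, nB'.1, fun h' =>
        (ha (h.away_of_away h')).elim⟩, fun h => (Nat.lt_irrefl 0 h).elim⟩

end LTerm

end WeakLambda

theorem mainTheorem1 (S : List ℕ) (M N : WeakLambda.Term) :
    (WeakLambda.Superstep S 0 M N →
      ∃ A B : WeakLambda.LTerm, A.erase = M ∧ B.erase = N ∧ WeakLambda.LTerm.Steps S A B) ∧
    (∀ A B : WeakLambda.LTerm, A.erase = M → B.erase = N →
      WeakLambda.LTerm.Steps S A B → WeakLambda.LTerm.IsNormal S B →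
      WeakLambda.Superstep S 0 M N) := by
  constructor
  · intro h
    obtain ⟨A, B, hA, hB, h⟩ := h.exists_eval
    exact ⟨A, B, hA, hB, h.headSteps⟩
  · rintro A B rfl rfl h hB
    obtain ⟨k, j, C, hk, hC, nC⟩ :=
      WeakLambda.LTerm.exists_eval_normal A.erase A rfl S 0 (Or.inl rfl)
    obtain ⟨rfl, rfl⟩ := Nat.add_eq_zero_iff.1 hk.symm
    rw [h.normal_unique hC.headSteps hB nC.1]
    exact hC.superstep
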